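/- Let $\mathrm{Li}_3(x)=\sum_{n\ge1}x^n/n^3$ for real $|x|\le1$, let $\zeta$ be the Riemann zeta function, and for real $y$ let $$S(y)=\sum_{n=1}^{\infty}\frac{(-1)^n\,\zeta(2n)}{2n(2n+1)(2n+2)}\,y^{2n}.$$ (i) Put $m=\ln\frac32$, $A=\ln\frac{\sqrt2+\sqrt3}{2\sqrt2}$, $B=\ln\frac{2\sqrt3}{\sqrt2+\sqrt3}$ and $C=\ln\frac{5+2\sqrt6}{4\sqrt6}$. Then the four series below converge and $$\begin{aligned}\mathrm{Li}_3\left(\frac23\right)={}&\zeta(3)-\frac{2\pi^2}{3}m+\frac1{12}m^3+\frac32m^2-m^2\ln\left(\frac m2\right)+\frac{4\pi^2}{3}A-\frac23A^3-6A^2+4A^2\ln A\\&-\frac{\pi^2}{3}C+\frac16C^3+\frac32C^2-C^2\ln C+\frac{2\pi^2}{3}B+\frac23B^3-6B^2+4B^2\ln B\\&+4m^2\,S\left(\frac{m}{4\pi}\right)-16A^2\,S\left(\frac{A}{2\pi}\right)-16B^2\,S\left(\frac{B}{2\pi}\right)+4C^2\,S\left(\frac{C}{2\pi}\right).\end{aligned}$$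 (ii) Put $m=\ln\frac43$, $A=\ln\frac{2+\sqrt3}{2\sqrt3}$, $B=\ln\frac{4}{2+\sqrt3}$ and $C=\ln\frac{7+4\sqrt3}{8\sqrt3}$. Then the four series below converge and $$\begin{aligned}\mathrm{Li}_3\left(\frac34\right)={}&\zeta(3)-\frac{2\pi^2}{3}m+\frac1{12}m^3+\frac32m^2-m^2\ln\left(\frac m2\right)+\frac{4\pi^2}{3}A-\frac23A^3-6A^2+4A^2\ln A\\&-\frac{\pi^2}{3}C+\frac16C^3+\frac32C^2-C^2\ln C+\frac{2\pi^2}{3}B+\frac23B^3-6B^2+4B^2\ln B\\&+4m^2\,S\left(\frac{m}{4\pi}\right)-16A^2\,S\left(\frac{A}{2\pi}\right)-16B^2\,S\left(\frac{B}{2\pi}\right)+4C^2\,S\left(\frac{C}{2\pi}\right).\end{aligned}$$ -/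

import Mathlib

/-- The trilogarithm `Li₃(x) = ∑_{n ≥ 1} xⁿ / n³` of a real argument `|x| ≤ 1`. -/
noncomputable def Li3 (x : ℝ) : ℝ := ∑' n : ℕ, x ^ (n + 1) / ((n : ℝ) + 1) ^ 3

/-- The defining series of the trilogarithm converges for `|x| ≤ 1`. -/
theorem Li3_hasSum {x : ℝ} (hx : |x| ≤ 1) :
    HasSum (fun n : ℕ => x ^ (n + 1) / ((n : ℝ) + 1) ^ 3) (Li3 x) := by
  refine Summable.hasSum ?_
  have h : Summable (fun n : ℕ => 1 / ((n : ℝ) + 1) ^ 3) := by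
    have h0 := (summable_nat_add_iff 1).2 (Real.summable_one_div_nat_pow.2 (by norm_num : 1 < 3))
    simpa using h0
  refine Summable.of_norm_bounded h fun n => ?_
  have hp : (0 : ℝ) < ((n : ℝ) + 1) ^ 3 := by positivity
  rw [Real.norm_eq_abs, abs_div, abs_of_pos hp, abs_pow]
  gcongr
  exact pow_le_one₀ (abs_nonneg x) hx

/-- The value `ζ(k)` of the Riemann zeta function at a natural number, as a real number. -/
noncomputable def zetaNat (k : ℕ) : ℝ := (riemannZeta (k : ℂ)).re

/-- For `k ≥ 2` the value of the Riemann zeta function at `k` is real, so that taking the real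
part loses nothing. -/
theorem zetaNat_coe {k : ℕ} (hk : 2 ≤ k) : ((zetaNat k : ℝ) : ℂ) = riemannZeta (k : ℂ) := by
  have h : riemannZeta (k : ℂ) = ((∑' n : ℕ, 1 / (n : ℝ) ^ k : ℝ) : ℂ) := by
    rw [zeta_nat_eq_tsum_of_gt_one (by omega)]
    push_cast
    rfl
  rw [zetaNat, h, Complex.ofReal_re]

/-- The term `(-1)ⁿ ζ(2n) / (2n (2n+1) (2n+2)) y²ⁿ`, which is used for `n ≥ 1`. -/
noncomputable def zetaTerm (y : ℝ) (n : ℕ) : ℝ :=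
  (-1) ^ n * zetaNat (2 * n) / ((2 * n) * (2 * n + 1) * (2 * n + 2)) * y ^ (2 * n)

/-- The series `∑_{n ≥ 1} (-1)ⁿ ζ(2n) / (2n (2n+1) (2n+2)) y²ⁿ`. -/
noncomputable def zetaSeries (y : ℝ) : ℝ := ∑' n : ℕ, zetaTerm y (n + 1)

/-! Two facts combine. The first is a functional equation for `0 < z < 1` (`Li3_sq`): up to powers
of `log (2/(1+z))` and multiples of `ζ(3)`, `Li₃(z²)` is a combination of `Li₃` at `z`, `2z/(1+z)`,
`(1+z)/2` and `4z/(1+z)²`. All these arguments tend to `1` as `z → 1`, and the equation follows by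
differentiating, once two analogous relations for `Li₂` are known (`Li2_sq_relation`,
`Li2_half_relation`).

The second is the expansion of `Li₃(e^{-t})` for `0 < t < 2π` (`Li3_exp_neg`). Two integrations from
`t = 0` reduce it to `log (1 - e^{-t})`, which is elementary apart from `log (sinh (t/2) / (t/2))`.
Euler's product turns that into a power series in `t/(2π)` with coefficients `ζ(2n)/n`, and the two
integrations supply the remaining denominators of `S`.

With `z = √(2/3)` and `z = √3/2`, the numbers `m/2`, `A`, `B`, `C` are minus the logarithms of `z`,
`2z/(1+z)`, `(1+z)/2`, `4z/(1+z)²`. -/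

/-- A power series with bounded coefficients may be integrated termwise in the unit interval. -/
theorem hasDerivAt_tsum_pow {c : ℕ → ℝ} {e : ℕ → ℕ} {M x : ℝ} (hc : ∀ n, |c n| ≤ M)
    (he : ∀ n, n ≤ e n) (hx : |x| < 1) :
    HasDerivAt (fun y : ℝ => ∑' n, c n / ((e n : ℝ) + 1) * y ^ (e n + 1))
      (∑' n, c n * x ^ e n) x := by
  obtain ⟨r, hxr, hr1⟩ := exists_between hx
  have hr0 : 0 ≤ r := (abs_nonneg x).trans hxr.le
  -- On `(-r, r)` the derivatives are dominated by `M * r ^ n`, because `n ≤ e n`; at the base point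
  -- `0` every term vanishes.
  refine hasDerivAt_tsum_of_isPreconnected
    (g := fun n y => c n / ((e n : ℝ) + 1) * y ^ (e n + 1)) (g' := fun n y => c n * y ^ e n) (u := fun n => M * r ^ n) (t := Set.Ioo (-r) r)
    (y₀ := 0) ((summable_geometric_of_lt_one hr0 hr1).mul_left M) isOpen_Ioo isPreconnected_Ioo
    (fun n y _ => ?_) (fun n y hy => ?_) ⟨by linarith [abs_nonneg x], (abs_nonneg x).trans_lt hxr⟩
    ?_ (abs_lt.1 hxr)
  · have h := (hasDerivAt_pow (e n + 1) y).const_mul (c n / ((e n : ℝ) + 1))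
    refine h.congr_deriv ?_
    have : (e n : ℝ) + 1 ≠ 0 := by positivity
    push_cast
    field_simp
  · rw [Real.norm_eq_abs, abs_mul, abs_pow]
    have hy' : |y| ≤ r := (abs_lt.2 hy).le
    have h1 : |y| ^ e n ≤ r ^ n :=
      (pow_le_pow_left₀ (abs_nonneg y) hy' _).trans (pow_le_pow_of_le_one hr0 hr1.le (he n))
    exact mul_le_mul (hc n) h1 (by positivity) ((abs_nonneg _).trans (hc n))
  · simp

/-! ### Derivatives and boundary values of `Li₂` and `Li₃`. -/

/-- The dilogarithm `Li₂(x) = ∑_{n ≥ 1} xⁿ / n²` of a real argument. -/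
noncomputable def Li2 (x : ℝ) : ℝ := ∑' n : ℕ, x ^ (n + 1) / ((n : ℝ) + 1) ^ 2

theorem summable_one_div_succ_pow {k : ℕ} (hk : 1 < k) :
    Summable fun n : ℕ => 1 / ((n : ℝ) + 1) ^ k := by
  have h0 := (summable_nat_add_iff 1).2 (Real.summable_one_div_nat_pow.2 hk)
  simpa using h0

theorem continuousOn_tsum_pow_div {k : ℕ} (hk : 1 < k) :
    ContinuousOn (fun x : ℝ => ∑' n : ℕ, x ^ (n + 1) / ((n : ℝ) + 1) ^ k) (Set.Icc (-1) 1) := by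
  refine continuousOn_tsum (fun n => by fun_prop) (summable_one_div_succ_pow hk) fun n x hx => ?_
  have hp : (0 : ℝ) < ((n : ℝ) + 1) ^ k := by positivity
  rw [Real.norm_eq_abs, abs_div, abs_of_pos hp, abs_pow]
  gcongr
  exact pow_le_one₀ (abs_nonneg x) (abs_le.2 hx)

theorem continuousOn_Li2 : ContinuousOn Li2 (Set.Icc (-1) 1) :=
  continuousOn_tsum_pow_div one_lt_two

theorem continuousOn_Li3 : ContinuousOn Li3 (Set.Icc (-1) 1) :=
  continuousOn_tsum_pow_div (by norm_num)

theorem hasDerivAt_Li3 {x : ℝ} (h0 : 0 < x) (h1 : x < 1) : HasDerivAt Li3 (Li2 x / x) x := by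
  have h := hasDerivAt_tsum_pow (c := fun n => 1 / ((n : ℝ) + 1) ^ 2) (e := fun n => n) (M := 1)
    (x := x) (fun n => ?_) (fun n => le_rfl) (abs_lt.2 ⟨by linarith, h1⟩)
  · convert h using 1
    · funext y
      refine tsum_congr fun n => ?_
      field_simp
    · rw [Li2, ← tsum_div_const]
      refine tsum_congr fun n => ?_
      field_simp
      ring
  · rw [abs_of_pos (by positivity), div_le_one (by positivity)]
    exact one_le_pow₀ (by linarith [(Nat.cast_nonneg n : (0 : ℝ) ≤ n)])

theorem hasDerivAt_Li2 {x : ℝ} (h0 : 0 < x) (h1 : x < 1) :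
    HasDerivAt Li2 (-Real.log (1 - x) / x) x := by
  have hx : |x| < 1 := abs_lt.2 ⟨by linarith, h1⟩
  have h := hasDerivAt_tsum_pow (c := fun n => 1 / ((n : ℝ) + 1)) (e := fun n => n) (M := 1)
    (x := x) (fun n => ?_) (fun n => le_rfl) hx
  · convert h using 1
    · funext y
      refine tsum_congr fun n => ?_
      field_simp
    · rw [← (Real.hasSum_pow_div_log_of_abs_lt_one hx).tsum_eq, ← tsum_div_const]
      refine tsum_congr fun n => ?_
      field_simp
      ring
  · rw [abs_of_pos (by positivity), div_le_one (by positivity)]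
    linarith [(Nat.cast_nonneg n : (0 : ℝ) ≤ n)]

theorem Li2_one : Li2 1 = Real.pi ^ 2 / 6 := by
  have h := (hasSum_nat_add_iff' 1).2 hasSum_zeta_two
  have h2 := h.tsum_eq
  simpa [Li2] using h2

theorem zetaNat_eq_tsum {k : ℕ} (hk : 1 < k) : zetaNat k = ∑' n : ℕ, 1 / ((n : ℝ) + 1) ^ k := by
  have h : riemannZeta (k : ℂ) = ((∑' n : ℕ, 1 / (n : ℝ) ^ k : ℝ) : ℂ) := by
    rw [zeta_nat_eq_tsum_of_gt_one hk]
    push_cast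
    rfl
  rw [zetaNat, h, Complex.ofReal_re, (Real.summable_one_div_nat_pow.2 hk).tsum_eq_zero_add]
  simp [show k ≠ 0 by omega]

theorem Li3_one : Li3 1 = zetaNat 3 := by
  rw [zetaNat_eq_tsum (by norm_num), Li3]
  simp

theorem hasDerivAt_Li3_comp {f : ℝ → ℝ} {f' x : ℝ} (hf : HasDerivAt f f' x) (h0 : 0 < f x)
    (h1 : f x < 1) : HasDerivAt (fun y => Li3 (f y)) (Li2 (f x) * (f' / f x)) x :=
  ((hasDerivAt_Li3 h0 h1).comp x hf).congr_deriv (by ring)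

theorem hasDerivAt_Li2_comp {f : ℝ → ℝ} {f' x : ℝ} (hf : HasDerivAt f f' x) (h0 : 0 < f x)
    (h1 : f x < 1) : HasDerivAt (fun y => Li2 (f y)) (-Real.log (1 - f x) * (f' / f x)) x :=
  ((hasDerivAt_Li2 h0 h1).comp x hf).congr_deriv (by ring)

/-- Differentiability is asked only in the interior: the polylogarithm identities are anchored at an
endpoint where the argument is `1`, and there only continuity is available. -/
theorem eq_of_hasDerivAt_zero {f : ℝ → ℝ} {a b : ℝ} (hab : a ≤ b)
    (hc : ContinuousOn f (Set.Icc a b)) (hd : ∀ x ∈ Set.Ioo a b, HasDerivAt f 0 x) :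
    f a = f b := by
  rcases hab.eq_or_lt with rfl | h
  · rfl
  obtain ⟨c, -, hc⟩ := exists_hasDerivAt_eq_slope f (fun _ => 0) h hc hd
  have := (div_eq_zero_iff.1 hc.symm).resolve_right (sub_ne_zero.2 h.ne')
  linarith

/-! ### A Landen-type functional equation for the trilogarithm. -/

section Landen

variable {z : ℝ}

theorem two_mul_div_lt_one (h0 : 0 < z) (h1 : z < 1) : 2 * z / (1 + z) < 1 := by
  rw [div_lt_one (by linarith)]; linarith

theorem four_mul_div_lt_one (h0 : 0 < z) (h1 : z < 1) : 4 * z / (1 + z) ^ 2 < 1 := by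
  rw [div_lt_one (by positivity)]; nlinarith [mul_pos (sub_pos.2 h1) (sub_pos.2 h1)]

theorem hasDerivAt_two_mul_div (h0 : 0 < z) :
    HasDerivAt (fun y : ℝ => 2 * y / (1 + y)) (2 / (1 + z) ^ 2) z := by
  have h := ((hasDerivAt_id z).const_mul 2).div ((hasDerivAt_id z).const_add 1)
    (by simp only [id]; positivity)
  exact h.congr_deriv (by simp only [id]; field_simp; ring)

theorem hasDerivAt_four_mul_div (h0 : 0 < z) :
    HasDerivAt (fun y : ℝ => 4 * y / (1 + y) ^ 2) (4 * (1 - z) / (1 + z) ^ 3) z := by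
  have h := ((hasDerivAt_id z).const_mul 4).div (((hasDerivAt_id z).const_add 1).pow 2)
    (by simp only [Pi.pow_apply, id]; positivity)
  exact h.congr_deriv (by simp only [Pi.pow_apply, id]; field_simp; norm_num; ring)

theorem hasDerivAt_half_one_add : HasDerivAt (fun y : ℝ => (1 + y) / 2) (1 / 2) z :=
  ((hasDerivAt_id z).const_add 1).div_const 2

theorem hasDerivAt_sq' : HasDerivAt (fun y : ℝ => y ^ 2) (2 * z) z := by
  simpa using hasDerivAt_pow 2 z

theorem hasDerivAt_log_two_div (h0 : 0 < z) :
    HasDerivAt (fun y : ℝ => Real.log (2 / (1 + y))) (-1 / (1 + z)) z := by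
  have h := ((hasDerivAt_const z (2 : ℝ)).div ((hasDerivAt_id z).const_add 1)
    (by simp only [id]; positivity)).log (by simp only [Pi.div_apply, id]; positivity)
  exact h.congr_deriv (by simp only [Pi.div_apply, id]; field_simp; ring)

theorem log_one_sub_sq (h0 : 0 < z) (h1 : z < 1) :
    Real.log (1 - z ^ 2) = Real.log (1 - z) + Real.log (1 + z) := by
  rw [← Real.log_mul (by linarith) (by linarith)]; ring_nf

theorem log_one_sub_two_mul_div (h0 : 0 < z) (h1 : z < 1) :
    Real.log (1 - 2 * z / (1 + z)) = Real.log (1 - z) - Real.log (1 + z) := by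
  rw [← Real.log_div (by linarith) (by linarith)]
  congr 1; field_simp; ring

theorem log_one_sub_four_mul_div (h0 : 0 < z) (h1 : z < 1) :
    Real.log (1 - 4 * z / (1 + z) ^ 2) = 2 * (Real.log (1 - z) - Real.log (1 + z)) := by
  rw [← Real.log_div (by linarith) (by linarith),
    show (2 : ℝ) = (2 : ℕ) by norm_num, ← Real.log_pow]
  congr 1; field_simp; ring

theorem log_one_sub_half_one_add (h1 : z < 1) :
    Real.log (1 - (1 + z) / 2) = Real.log (1 - z) - Real.log 2 := by
  rw [← Real.log_div (by linarith) (by norm_num)]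
  congr 1; ring

theorem continuousOn_comp_Li {L f : ℝ → ℝ} (hL : ContinuousOn L (Set.Icc (-1) 1)) (h0 : 0 < z)
    (hf : ContinuousOn f (Set.Icc z 1)) (h : ∀ y, 0 < y → y < 1 → 0 < f y ∧ f y < 1)
    (hf1 : f 1 = 1) : ContinuousOn (fun y => L (f y)) (Set.Icc z 1) := by
  refine hL.comp hf fun y hy => ?_
  rcases hy.2.eq_or_lt with rfl | hy1
  · rw [hf1]; norm_num
  · have := h y (h0.trans_le hy.1) hy1
    exact ⟨by linarith, this.2.le⟩

theorem continuousOn_Li_two_mul_div {L : ℝ → ℝ} (hL : ContinuousOn L (Set.Icc (-1) 1))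
    (h0 : 0 < z) : ContinuousOn (fun y => L (2 * y / (1 + y))) (Set.Icc z 1) := by
  refine continuousOn_comp_Li hL h0 (ContinuousOn.div (by fun_prop) (by fun_prop) fun y hy => ?_)
    (fun y hy hy1 => ⟨by positivity, two_mul_div_lt_one hy hy1⟩) (by norm_num)
  have := hy.1
  linarith

theorem continuousOn_Li_four_mul_div {L : ℝ → ℝ} (hL : ContinuousOn L (Set.Icc (-1) 1))
    (h0 : 0 < z) : ContinuousOn (fun y => L (4 * y / (1 + y) ^ 2)) (Set.Icc z 1) := by
  refine continuousOn_comp_Li hL h0 (ContinuousOn.div (by fun_prop) (by fun_prop) fun y hy => ?_)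
    (fun y hy hy1 => ⟨by positivity, four_mul_div_lt_one hy hy1⟩) (by norm_num)
  have := hy.1
  exact pow_ne_zero 2 (by linarith)

theorem continuousOn_Li_half_one_add {L : ℝ → ℝ} (hL : ContinuousOn L (Set.Icc (-1) 1))
    (h0 : 0 < z) : ContinuousOn (fun y => L ((1 + y) / 2)) (Set.Icc z 1) :=
  continuousOn_comp_Li hL h0 (by fun_prop)
    (fun y _ _ => ⟨by positivity, by linarith⟩) (by norm_num)

theorem continuousOn_Li_sq {L : ℝ → ℝ} (hL : ContinuousOn L (Set.Icc (-1) 1))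
    (h0 : 0 < z) : ContinuousOn (fun y => L (y ^ 2)) (Set.Icc z 1) :=
  continuousOn_comp_Li hL h0 (by fun_prop)
    (fun y _ _ => ⟨by positivity, by nlinarith⟩) (by norm_num)

theorem continuousOn_Li_id {L : ℝ → ℝ} (hL : ContinuousOn L (Set.Icc (-1) 1))
    (h0 : 0 < z) : ContinuousOn (fun y => L y) (Set.Icc z 1) :=
  continuousOn_comp_Li hL h0 (f := fun y => y) (by fun_prop)
    (fun _ hy hy1 => ⟨hy, hy1⟩) rfl

theorem continuousOn_log_two_div (h0 : 0 < z) :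
    ContinuousOn (fun y : ℝ => Real.log (2 / (1 + y))) (Set.Icc z 1) := fun _ hy =>
  (hasDerivAt_log_two_div (h0.trans_le hy.1)).continuousAt.continuousWithinAt

/-- After differentiation every logarithm is a combination of `log (1 - z)` and `log (1 + z)`, and
these cancel. At `z = 1` all arguments are `1` and the coefficients sum to `0`. -/
theorem Li2_sq_relation (h0 : 0 < z) (h1 : z < 1) :
    2 * Li2 (z ^ 2) - 8 * Li2 z + 8 * Li2 (2 * z / (1 + z)) - 2 * Li2 (4 * z / (1 + z) ^ 2) = 0 := by
  have key := eq_of_hasDerivAt_zero (a := z) (b := 1)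
    (f := fun z => 2 * Li2 (z ^ 2) - 8 * Li2 z + 8 * Li2 (2 * z / (1 + z))
      - 2 * Li2 (4 * z / (1 + z) ^ 2)) h1.le ?_ ?_
  · rw [key]
    norm_num
  · have c := continuousOn_Li2
    exact ((((continuousOn_Li_sq c h0).const_mul 2).sub ((continuousOn_Li_id c h0).const_mul 8)).add
      ((continuousOn_Li_two_mul_div c h0).const_mul 8)).sub
      ((continuousOn_Li_four_mul_div c h0).const_mul 2)
  · intro y hy
    have hy0 : 0 < y := h0.trans hy.1
    have hy1 : y < 1 := hy.2
    have d := ((((hasDerivAt_Li2_comp (x := y) hasDerivAt_sq' (by positivity) (by nlinarith)).const_mul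
      2).sub ((hasDerivAt_Li2 hy0 hy1).const_mul 8)).add ((hasDerivAt_Li2_comp
      (hasDerivAt_two_mul_div hy0) (by positivity) (two_mul_div_lt_one hy0 hy1)).const_mul 8)).sub
      ((hasDerivAt_Li2_comp (hasDerivAt_four_mul_div hy0) (by positivity)
      (four_mul_div_lt_one hy0 hy1)).const_mul 2)
    refine d.congr_deriv ?_
    rw [log_one_sub_sq hy0 hy1, log_one_sub_two_mul_div hy0 hy1, log_one_sub_four_mul_div hy0 hy1]
    field_simp
    ring

/-- The derivative vanishes as in `Li2_sq_relation`, the squared logarithm absorbing the `log 2`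
terms. At `z = 1` the coefficients leave `-4 * Li2 1`. -/
theorem Li2_half_relation (h0 : 0 < z) (h1 : z < 1) :
    8 * Li2 (2 * z / (1 + z)) - 8 * Li2 ((1 + z) / 2) - 4 * Li2 (4 * z / (1 + z) ^ 2)
      - 4 * Real.log (2 / (1 + z)) ^ 2 = - (2 * Real.pi ^ 2 / 3) := by
  have key := eq_of_hasDerivAt_zero (a := z) (b := 1)
    (f := fun z => 8 * Li2 (2 * z / (1 + z)) - 8 * Li2 ((1 + z) / 2)
      - 4 * Li2 (4 * z / (1 + z) ^ 2) - 4 * Real.log (2 / (1 + z)) ^ 2) h1.le ?_ ?_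
  · rw [key]
    norm_num [Li2_one]
    ring
  · have c := continuousOn_Li2
    exact ((((continuousOn_Li_two_mul_div c h0).const_mul 8).sub
      ((continuousOn_Li_half_one_add c h0).const_mul 8)).sub
      ((continuousOn_Li_four_mul_div c h0).const_mul 4)).sub
      (((continuousOn_log_two_div h0).pow 2).const_mul 4)
  · intro y hy
    have hy0 : 0 < y := h0.trans hy.1
    have hy1 : y < 1 := hy.2
    have d := ((((hasDerivAt_Li2_comp
      (hasDerivAt_two_mul_div hy0) (by positivity) (two_mul_div_lt_one hy0 hy1)).const_mul 8).sub
      ((hasDerivAt_Li2_comp (x := y) hasDerivAt_half_one_add (by positivity)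
      (by linarith)).const_mul 8)).sub
      ((hasDerivAt_Li2_comp (hasDerivAt_four_mul_div hy0) (by positivity)
      (four_mul_div_lt_one hy0 hy1)).const_mul 4)).sub
      (((hasDerivAt_log_two_div hy0).pow 2).const_mul 4)
    refine d.congr_deriv ?_
    rw [log_one_sub_half_one_add hy1, log_one_sub_two_mul_div hy0 hy1,
      log_one_sub_four_mul_div hy0 hy1, Real.log_div (by norm_num) (by positivity)]
    field_simp
    ring

theorem Li3_sq (h0 : 0 < z) (h1 : z < 1) :
    Li3 (z ^ 2) = 7 * zetaNat 3 + 8 * Li3 z - 8 * Li3 (2 * z / (1 + z)) - 8 * Li3 ((1 + z) / 2)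
      + 2 * Li3 (4 * z / (1 + z) ^ 2) - 2 * Real.pi ^ 2 / 3 * Real.log (2 / (1 + z))
      + 4 / 3 * Real.log (2 / (1 + z)) ^ 3 := by
  have key := eq_of_hasDerivAt_zero (a := z) (b := 1)
    (f := fun z => Li3 (z ^ 2) - 8 * Li3 z + 8 * Li3 (2 * z / (1 + z)) + 8 * Li3 ((1 + z) / 2)
      - 2 * Li3 (4 * z / (1 + z) ^ 2) + 2 * Real.pi ^ 2 / 3 * Real.log (2 / (1 + z))
      - 4 / 3 * Real.log (2 / (1 + z)) ^ 3) h1.le ?_ ?_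
  · beta_reduce at key
    norm_num [Li3_one] at key
    linarith
  · have c := continuousOn_Li3
    exact ((((((continuousOn_Li_sq c h0).sub ((continuousOn_Li_id c h0).const_mul 8)).add
      ((continuousOn_Li_two_mul_div c h0).const_mul 8)).add
      ((continuousOn_Li_half_one_add c h0).const_mul 8)).sub
      ((continuousOn_Li_four_mul_div c h0).const_mul 2)).add
      ((continuousOn_log_two_div h0).const_mul _)).sub
      (((continuousOn_log_two_div h0).pow 3).const_mul _)
  · intro y hy
    have hy0 : 0 < y := h0.trans hy.1
    have hy1 : y < 1 := hy.2
    have d := (((((((hasDerivAt_Li3_comp (x := y) hasDerivAt_sq' (by positivity)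
      (by nlinarith))).sub ((hasDerivAt_Li3 hy0 hy1).const_mul 8)).add ((hasDerivAt_Li3_comp
      (hasDerivAt_two_mul_div hy0) (by positivity) (two_mul_div_lt_one hy0 hy1)).const_mul 8)).add
      ((hasDerivAt_Li3_comp (x := y) hasDerivAt_half_one_add (by positivity)
      (by linarith)).const_mul 8)).sub
      ((hasDerivAt_Li3_comp (hasDerivAt_four_mul_div hy0) (by positivity)
      (four_mul_div_lt_one hy0 hy1)).const_mul 2)).add
      ((hasDerivAt_log_two_div hy0).const_mul (2 * Real.pi ^ 2 / 3))).sub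
      (((hasDerivAt_log_two_div hy0).pow 3).const_mul (4 / 3))
    refine d.congr_deriv ?_
    have e1 := Li2_sq_relation hy0 hy1
    have e2 := Li2_half_relation hy0 hy1
    generalize Li2 (2 * y / (1 + y)) = a, Li2 ((1 + y) / 2) = b,
      Li2 (4 * y / (1 + y) ^ 2) = c, Li2 (y ^ 2) = d, Li2 y = e,
      Real.log (2 / (1 + y)) = l at e1 e2 ⊢
    field_simp
    -- Since `1/(y(1+y)) = 1/y - 1/(1+y)`, the derivative is relation `e1` over `y` minus relation
    -- `e2` over `1 + y`. The `3` clears numerical denominators.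
    linear_combination 3 * (1 + y) * e1 - 3 * y * e2

end Landen

/-! ### The zeta series and the hyperbolic sine. -/

theorem hasSum_log_one_add_sq_div {y : ℝ} (hy : 0 < y) :
    HasSum (fun j : ℕ => Real.log (1 + y ^ 2 / ((j : ℝ) + 1) ^ 2))
      (Real.log (Real.sinh (Real.pi * y) / (Real.pi * y))) := by
  have hpy : 0 < Real.pi * y := mul_pos Real.pi_pos hy
  have hp : ∀ j : ℕ, 0 < 1 + y ^ 2 / ((j : ℝ) + 1) ^ 2 := fun j => by positivity
  rw [hasSum_iff_tendsto_nat_of_nonneg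
    (fun j => Real.log_nonneg (le_add_of_nonneg_right (by positivity)))]
  -- At `iy` the sine product becomes that of `sinh (π y)`, read off from imaginary parts.
  have h := Complex.tendsto_euler_sin_prod ((y : ℂ) * Complex.I)
  have h2 : Filter.Tendsto
      (fun n => Real.pi * y * ∏ j ∈ Finset.range n, (1 + y ^ 2 / ((j : ℝ) + 1) ^ 2)) Filter.atTop
      (nhds (Real.sinh (Real.pi * y))) := by
    convert! (Complex.continuous_im.tendsto _).comp h using 1
    · funext n
      have e : (Real.pi : ℂ) * (y * Complex.I) * ∏ j ∈ Finset.range n,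
          (1 - (y * Complex.I) ^ 2 / ((j : ℂ) + 1) ^ 2) =
          ((Real.pi * y * ∏ j ∈ Finset.range n, (1 + y ^ 2 / ((j : ℝ) + 1) ^ 2) : ℝ) : ℂ)
            * Complex.I := by
        push_cast
        simp only [mul_pow, Complex.I_sq, mul_neg_one, neg_div, sub_neg_eq_add]
        ring
      simp only [Function.comp_apply]
      rw [e, Complex.im_ofReal_mul, Complex.I_im, mul_one]
    · rw [← mul_assoc, Complex.sin_mul_I, ← Complex.ofReal_mul, ← Complex.ofReal_sinh,
        Complex.im_ofReal_mul, Complex.I_im, mul_one]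
  have h3 := (h2.div_const (Real.pi * y)).log
    (div_pos (Real.sinh_pos_iff.2 hpy) hpy).ne'
  refine h3.congr fun n => ?_
  rw [mul_div_cancel_left₀ _ hpy.ne', Real.log_prod (fun j _ => (hp j).ne')]

theorem abs_zetaNat_le {k : ℕ} (hk : 2 ≤ k) : |zetaNat k| ≤ zetaNat 2 := by
  rw [zetaNat_eq_tsum (by omega), zetaNat_eq_tsum one_lt_two,
    abs_of_nonneg (tsum_nonneg fun n => by positivity)]
  refine (summable_one_div_succ_pow (by omega)).tsum_le_tsum (fun n => ?_)
    (summable_one_div_succ_pow one_lt_two)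
  refine one_div_le_one_div_of_le (by positivity) (pow_le_pow_right₀ ?_ hk)
  linarith [(Nat.cast_nonneg n : (0 : ℝ) ≤ n)]

theorem abs_div_le_of_one_le {a b M : ℝ} (ha : |a| ≤ M) (hb : 1 ≤ b) : |a / b| ≤ M := by
  rw [abs_div, abs_of_pos (by linarith : 0 < b)]
  exact (div_le_self (abs_nonneg a) hb).trans ha

theorem abs_neg_one_pow_mul_zetaNat_le (n : ℕ) :
    |(-1) ^ (n + 1) * zetaNat (2 * (n + 1))| ≤ zetaNat 2 := by
  rw [abs_mul, abs_pow, abs_neg, abs_one, one_pow, one_mul]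
  exact abs_zetaNat_le (by omega)

theorem summable_zetaTerm {y : ℝ} (hy : |y| < 1) : Summable fun n : ℕ => zetaTerm y (n + 1) := by
  refine Summable.of_norm_bounded
    ((summable_geometric_of_lt_one (abs_nonneg y) hy).mul_left (zetaNat 2)) fun n => ?_
  rw [zetaTerm, Real.norm_eq_abs, abs_mul, abs_pow]
  refine mul_le_mul (abs_div_le_of_one_le (abs_neg_one_pow_mul_zetaNat_le n) ?_)
    (pow_le_pow_of_le_one (abs_nonneg y) hy.le (by omega)) (by positivity)
    ((abs_nonneg _).trans (abs_zetaNat_le le_rfl))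
  have hn : (0 : ℝ) ≤ n := n.cast_nonneg
  push_cast
  nlinarith [mul_nonneg hn hn, mul_nonneg (mul_nonneg hn hn) hn]

/-- `y² ∑_{n ≥ 1} (-1)ⁿ ζ(2n) / (2n (2n+1) (2n+2)) y²ⁿ`, normalised as an iterated integral. -/
noncomputable def zetaPrimitive₂ (y : ℝ) : ℝ :=
  ∑' n : ℕ, (-1) ^ (n + 1) * zetaNat (2 * (n + 1)) / (2 * n + 2) / (2 * n + 3) / (2 * n + 4)
    * y ^ (2 * n + 4)

/-- The derivative of `zetaPrimitive₂`. -/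
noncomputable def zetaPrimitive₁ (y : ℝ) : ℝ :=
  ∑' n : ℕ, (-1) ^ (n + 1) * zetaNat (2 * (n + 1)) / (2 * n + 2) / (2 * n + 3) * y ^ (2 * n + 3)

theorem sq_mul_zetaSeries (y : ℝ) : y ^ 2 * zetaSeries y = zetaPrimitive₂ y := by
  rw [zetaSeries, zetaPrimitive₂, ← tsum_mul_left]
  refine tsum_congr fun n => ?_
  rw [zetaTerm, div_div, div_div]
  push_cast
  ring

theorem zetaPrimitive₂_zero : zetaPrimitive₂ 0 = 0 := by simp [zetaPrimitive₂]

theorem zetaPrimitive₁_zero : zetaPrimitive₁ 0 = 0 := by simp [zetaPrimitive₁]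

theorem hasDerivAt_zetaPrimitive₂ {y : ℝ} (hy : |y| < 1) :
    HasDerivAt zetaPrimitive₂ (zetaPrimitive₁ y) y := by
  have h := hasDerivAt_tsum_pow (M := zetaNat 2) (x := y) (e := fun n => 2 * n + 3)
    (c := fun n => (-1) ^ (n + 1) * zetaNat (2 * (n + 1)) / (2 * n + 2) / (2 * n + 3))
    (fun n => abs_div_le_of_one_le (abs_div_le_of_one_le (abs_neg_one_pow_mul_zetaNat_le n) ?_) ?_)
    (fun n => by omega) hy
  · refine h.congr_of_eventuallyEq (Filter.Eventually.of_forall fun x => tsum_congr fun n => ?_)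
    push_cast
    ring
  all_goals linarith [(Nat.cast_nonneg n : (0 : ℝ) ≤ n)]

theorem hasDerivAt_zetaPrimitive₁ {y : ℝ} (hy : |y| < 1) :
    HasDerivAt zetaPrimitive₁
      (∑' n : ℕ, (-1) ^ (n + 1) * zetaNat (2 * (n + 1)) / (2 * n + 2) * y ^ (2 * n + 2)) y := by
  have h := hasDerivAt_tsum_pow (M := zetaNat 2) (x := y) (e := fun n => 2 * n + 2)
    (c := fun n => (-1) ^ (n + 1) * zetaNat (2 * (n + 1)) / (2 * n + 2))
    (fun n => abs_div_le_of_one_le (abs_neg_one_pow_mul_zetaNat_le n) ?_)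
    (fun n => by omega) hy
  · convert h using 1
    funext x
    refine tsum_congr fun n => ?_
    push_cast
    ring
  · linarith [(Nat.cast_nonneg n : (0 : ℝ) ≤ n)]

/-- Writing `ζ(2n)` as a sum over `j` and exchanging the summations, the sum over `n` is the Taylor
series of `-log (1 + y²/j²)`; the sum over `j` is then Euler's product. -/
theorem tsum_zetaNat_eq_log_sinh {y : ℝ} (h0 : 0 < y) (h1 : y < 1) :
    ∑' n : ℕ, (-1) ^ (n + 1) * zetaNat (2 * (n + 1)) / (2 * n + 2) * y ^ (2 * n + 2) =
      -(1 / 2) * Real.log (Real.sinh (Real.pi * y) / (Real.pi * y)) := by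
  have hs : Summable (Function.uncurry fun j n : ℕ =>
      (-(y ^ 2 / ((j : ℝ) + 1) ^ 2)) ^ (n + 1) / ((n : ℝ) + 1)) := by
    -- The majorant is `1/(j+1)² * yⁿ`: one factor `1/(j+1)²` suffices for `j`, and `y^(2(n+1)) ≤
    -- yⁿ` for `n`.
    refine Summable.of_norm_bounded ((summable_one_div_succ_pow one_lt_two).mul_of_nonneg
      (summable_geometric_of_lt_one h0.le h1) (fun _ => by positivity) fun _ => by positivity) ?_
    rintro ⟨j, n⟩
    have hj : (1 : ℝ) ≤ ((j : ℝ) + 1) ^ 2 :=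
      one_le_pow₀ (by linarith [(Nat.cast_nonneg j : (0 : ℝ) ≤ j)])
    have hj1 : 1 / ((j : ℝ) + 1) ^ 2 ≤ 1 := by rw [div_le_one (by positivity)]; exact hj
    simp only [Function.uncurry_apply_pair, Real.norm_eq_abs]
    refine abs_div_le_of_one_le ?_ (by linarith [(Nat.cast_nonneg n : (0 : ℝ) ≤ n)])
    rw [abs_pow, abs_neg, abs_of_nonneg (by positivity), div_eq_mul_one_div, mul_pow, mul_comm]
    refine mul_le_mul ?_ ?_ (by positivity) (by positivity)
    · simpa using pow_le_pow_of_le_one (by positivity) hj1 (show 1 ≤ n + 1 by omega)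
    · rw [← pow_mul]
      exact pow_le_pow_of_le_one h0.le h1.le (by omega)
  have hj : ∀ j : ℕ, ∑' n : ℕ, (-(y ^ 2 / ((j : ℝ) + 1) ^ 2)) ^ (n + 1) / ((n : ℝ) + 1) =
      -Real.log (1 + y ^ 2 / ((j : ℝ) + 1) ^ 2) := fun j => by
    have hlt : |-(y ^ 2 / ((j : ℝ) + 1) ^ 2)| < 1 := by
      rw [abs_neg, abs_of_nonneg (by positivity), div_lt_one (by positivity)]
      refine pow_lt_pow_left₀ ?_ h0.le two_ne_zero
      linarith [(Nat.cast_nonneg j : (0 : ℝ) ≤ j)]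
    rw [(Real.hasSum_pow_div_log_of_abs_lt_one hlt).tsum_eq, sub_neg_eq_add]
  have hn : ∀ n : ℕ, ∑' j : ℕ, (-(y ^ 2 / ((j : ℝ) + 1) ^ 2)) ^ (n + 1) / ((n : ℝ) + 1) =
      2 * ((-1) ^ (n + 1) * zetaNat (2 * (n + 1)) / (2 * n + 2) * y ^ (2 * n + 2)) := fun n => by
    rw [zetaNat_eq_tsum (by omega)]
    have e : ∀ j : ℕ, (-(y ^ 2 / ((j : ℝ) + 1) ^ 2)) ^ (n + 1) / ((n : ℝ) + 1) =
        (-1) ^ (n + 1) * y ^ (2 * n + 2) / (n + 1) * (1 / ((j : ℝ) + 1) ^ (2 * (n + 1))) :=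
      fun j => by
        rw [neg_pow, div_pow, ← pow_mul, ← pow_mul, show 2 * (n + 1) = 2 * n + 2 by ring]
        field_simp
    rw [tsum_congr e, tsum_mul_left]
    field_simp
  have h := hs.tsum_comm
  rw [tsum_congr hn, tsum_congr hj, tsum_neg, tsum_mul_left,
    (hasSum_log_one_add_sq_div h0).tsum_eq] at h
  linarith

/-- From `1 - e^{-t} = 2 e^{-t/2} sinh (t/2)`; the singular `log t` is split off so that the
remaining logarithm is the one with a power series. -/
theorem log_one_sub_exp_neg {t : ℝ} (ht : 0 < t) :
    Real.log (1 - Real.exp (-t)) =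
      Real.log (Real.sinh (t / 2) / (t / 2)) + Real.log t - t / 2 := by
  have hs : 0 < Real.sinh (t / 2) := Real.sinh_pos_iff.2 (by positivity)
  have e : 1 - Real.exp (-t) = Real.sinh (t / 2) / (t / 2) * t * Real.exp (-(t / 2)) := by
    have h1 : Real.exp (t / 2) * Real.exp (-(t / 2)) = 1 := by rw [← Real.exp_add]; simp
    have h2 : Real.exp (-t) = Real.exp (-(t / 2)) * Real.exp (-(t / 2)) := by
      rw [← Real.exp_add]; ring_nf
    rw [Real.sinh_eq, h2]
    field_simp
    linear_combination -h1
  rw [e, Real.log_mul (by positivity) (Real.exp_ne_zero _), Real.log_mul (by positivity) ht.ne',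
    Real.log_exp]
  ring

/-! ### Expansion of `Li₂(e^{-t})` and `Li₃(e^{-t})` in `t`. -/

section Expansion

variable {t : ℝ}

theorem abs_div_two_pi_lt_one (h0 : 0 ≤ t) (h1 : t < 2 * Real.pi) : |t / (2 * Real.pi)| < 1 := by
  rw [abs_of_nonneg (by positivity), div_lt_one (by positivity)]
  exact h1

theorem hasDerivAt_exp_neg : HasDerivAt (fun s : ℝ => Real.exp (-s)) (-Real.exp (-t)) t := by
  simpa using (hasDerivAt_neg t).exp

theorem continuousOn_comp_exp_neg {L : ℝ → ℝ} (hL : ContinuousOn L (Set.Icc (-1) 1)) :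
    ContinuousOn (fun s => L (Real.exp (-s))) (Set.Icc 0 t) := by
  refine hL.comp (by fun_prop) fun s hs => ?_
  exact ⟨by linarith [Real.exp_pos (-s)], Real.exp_le_one_iff.2 (by linarith [hs.1])⟩

theorem hasDerivAt_comp_div_two_pi {f : ℝ → ℝ} {f' : ℝ}
    (h : HasDerivAt f f' (t / (2 * Real.pi))) :
    HasDerivAt (fun s => f (s / (2 * Real.pi))) (f' / (2 * Real.pi)) t :=
  (h.comp t ((hasDerivAt_id t).div_const (2 * Real.pi))).congr_deriv (by ring)

/-- The derivative of `Li₂(e^{-t})` is `log (1 - e^{-t})`, integrated from `t = 0`. The bound `t <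
2π` keeps `t/(2π)` inside the unit interval where the series is differentiated. -/
theorem Li2_exp_neg (h0 : 0 < t) (h1 : t < 2 * Real.pi) :
    Li2 (Real.exp (-t)) = Real.pi ^ 2 / 6 - t ^ 2 / 4 - t + t * Real.log t
      - 4 * Real.pi * zetaPrimitive₁ (t / (2 * Real.pi)) := by
  have key := eq_of_hasDerivAt_zero (a := 0) (b := t)
    (f := fun t => Li2 (Real.exp (-t)) + t ^ 2 / 4 + t - t * Real.log t
      + 4 * Real.pi * zetaPrimitive₁ (t / (2 * Real.pi))) h0.le ?_ ?_
  · simp only [neg_zero, Real.exp_zero, Li2_one, zero_div, zetaPrimitive₁_zero, zero_mul,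
      mul_zero] at key
    linarith
  · have c : ContinuousOn (fun s => zetaPrimitive₁ (s / (2 * Real.pi))) (Set.Icc 0 t) :=
      fun s hs => (hasDerivAt_comp_div_two_pi (hasDerivAt_zetaPrimitive₁
        (abs_div_two_pi_lt_one hs.1 (hs.2.trans_lt h1)))).continuousAt.continuousWithinAt
    exact ((((continuousOn_comp_exp_neg continuousOn_Li2).add (by fun_prop)).add
      continuousOn_id).sub Real.continuous_mul_log.continuousOn).add (c.const_mul _)
  · intro s hs
    have hs0 : 0 < s := hs.1
    have hs1 : s < 2 * Real.pi := hs.2.trans h1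
    have hb := abs_div_two_pi_lt_one hs0.le hs1
    have d := ((((hasDerivAt_Li2_comp (x := s) hasDerivAt_exp_neg (Real.exp_pos _)
      (Real.exp_lt_one_iff.2 (by linarith))).add ((hasDerivAt_pow 2 s).div_const 4)).add
      (hasDerivAt_id s)).sub (Real.hasDerivAt_mul_log hs0.ne')).add
      ((hasDerivAt_comp_div_two_pi (hasDerivAt_zetaPrimitive₁ hb)).const_mul (4 * Real.pi))
    refine d.congr_deriv ?_
    rw [tsum_zetaNat_eq_log_sinh (by positivity) (abs_lt.1 hb).2, log_one_sub_exp_neg hs0,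
      show Real.pi * (s / (2 * Real.pi)) = s / 2 by field_simp]
    have := Real.exp_ne_zero (-s)
    field_simp
    ring

/-- The derivative of `Li₃(e^{-t})` is `-Li₂(e^{-t})`, so `Li2_exp_neg` is integrated once more. -/
theorem Li3_exp_neg (h0 : 0 < t) (h1 : t < 2 * Real.pi) :
    Li3 (Real.exp (-t)) = zetaNat 3 - Real.pi ^ 2 / 6 * t + t ^ 3 / 12 + 3 / 4 * t ^ 2
      - t ^ 2 / 2 * Real.log t + 2 * t ^ 2 * zetaSeries (t / (2 * Real.pi)) := by
  have key := eq_of_hasDerivAt_zero (a := 0) (b := t)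
    (f := fun t => Li3 (Real.exp (-t)) + Real.pi ^ 2 / 6 * t - t ^ 3 / 12 - 3 / 4 * t ^ 2
      -- Grouped so that continuity at `0` comes from that of `t log t`.
      + t / 2 * (t * Real.log t)
      - 8 * Real.pi ^ 2 * zetaPrimitive₂ (t / (2 * Real.pi))) h0.le ?_ ?_
  · simp only [neg_zero, Real.exp_zero, Li3_one, zero_div, zetaPrimitive₂_zero, zero_mul,
      mul_zero, ← sq_mul_zetaSeries (t / (2 * Real.pi))] at key
    have e : 8 * Real.pi ^ 2 * ((t / (2 * Real.pi)) ^ 2 * zetaSeries (t / (2 * Real.pi))) =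
        2 * t ^ 2 * zetaSeries (t / (2 * Real.pi)) := by
      rw [div_pow, mul_pow]
      field_simp
      ring
    rw [e] at key
    linarith
  · have c : ContinuousOn (fun s => zetaPrimitive₂ (s / (2 * Real.pi))) (Set.Icc 0 t) :=
      fun s hs => (hasDerivAt_comp_div_two_pi (hasDerivAt_zetaPrimitive₂
        (abs_div_two_pi_lt_one hs.1 (hs.2.trans_lt h1)))).continuousAt.continuousWithinAt
    exact (((((continuousOn_comp_exp_neg continuousOn_Li3).add (by fun_prop)).sub
      (by fun_prop)).sub (by fun_prop)).add (ContinuousOn.mul (by fun_prop)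
      Real.continuous_mul_log.continuousOn)).sub (c.const_mul _)
  · intro s hs
    have hs0 : 0 < s := hs.1
    have hs1 : s < 2 * Real.pi := hs.2.trans h1
    have hb := abs_div_two_pi_lt_one hs0.le hs1
    have d := (((((hasDerivAt_Li3_comp (x := s) hasDerivAt_exp_neg (Real.exp_pos _)
      (Real.exp_lt_one_iff.2 (by linarith))).add ((hasDerivAt_id s).const_mul (Real.pi ^ 2 / 6))).sub
      ((hasDerivAt_pow 3 s).div_const 12)).sub ((hasDerivAt_pow 2 s).const_mul (3 / 4))).add
      (((hasDerivAt_id s).div_const 2).mul (Real.hasDerivAt_mul_log hs0.ne'))).sub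
      ((hasDerivAt_comp_div_two_pi (hasDerivAt_zetaPrimitive₂ hb)).const_mul (8 * Real.pi ^ 2))
    refine d.congr_deriv ?_
    rw [Li2_exp_neg hs0 hs1]
    have := Real.exp_ne_zero (-s)
    simp only [id]
    field_simp
    push_cast
    ring

end Expansion

/-! ### Assembly and the two special values. -/

theorem log_mem_Ioo_of_mem_Ioo_one_two {x : ℝ} (h1 : 1 < x) (h2 : x < 2) :
    0 < Real.log x ∧ Real.log x < 2 * Real.pi := by
  refine ⟨Real.log_pos h1, ?_⟩
  have := Real.log_lt_sub_one_of_pos (by linarith : 0 < x) h1.ne'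
  linarith [Real.pi_gt_three]

theorem Li3_inv_of_mem_Ioo_one_two {x y : ℝ} (h1 : 1 < x) (h2 : x < 2) (hy : y = x⁻¹) :
    Li3 y = zetaNat 3 - Real.pi ^ 2 / 6 * Real.log x + Real.log x ^ 3 / 12
      + 3 / 4 * Real.log x ^ 2 - Real.log x ^ 2 / 2 * Real.log (Real.log x)
      + 2 * Real.log x ^ 2 * zetaSeries (Real.log x / (2 * Real.pi)) := by
  have h := log_mem_Ioo_of_mem_Ioo_one_two h1 h2
  rw [← Li3_exp_neg h.1 h.2, Real.exp_neg, Real.exp_log (by linarith), hy]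

theorem summable_zetaTerm_log {x : ℝ} (h1 : 1 < x) (h2 : x < 2) :
    Summable fun n : ℕ => zetaTerm (Real.log x / (2 * Real.pi)) (n + 1) := by
  have h := log_mem_Ioo_of_mem_Ioo_one_two h1 h2
  exact summable_zetaTerm (abs_div_two_pi_lt_one h.1.le h.2)

/-- Values of the trilogarithm at squares in terms of the series `zetaSeries`. -/
theorem Li3_sq_eq_zetaSeries {z w m A B C : ℝ} (hz : 1 / 2 < z) (hz1 : z < 1)
    (hw : z ^ 2 = w) (hm : m = Real.log (1 / w)) (hA : A = Real.log ((1 + z) / (2 * z)))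
    (hB : B = Real.log (2 / (1 + z))) (hC : C = Real.log ((1 + z) ^ 2 / (4 * z))) :
    Summable (fun n : ℕ => zetaTerm (m / (4 * Real.pi)) (n + 1)) ∧
    Summable (fun n : ℕ => zetaTerm (A / (2 * Real.pi)) (n + 1)) ∧
    Summable (fun n : ℕ => zetaTerm (B / (2 * Real.pi)) (n + 1)) ∧
    Summable (fun n : ℕ => zetaTerm (C / (2 * Real.pi)) (n + 1)) ∧
    Li3 w =
      zetaNat 3 - 2 * Real.pi ^ 2 / 3 * m + 1 / 12 * m ^ 3 + 3 / 2 * m ^ 2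
      - m ^ 2 * Real.log (1 / 2 * m)
      + 4 * Real.pi ^ 2 / 3 * A - 2 / 3 * A ^ 3 - 6 * A ^ 2 + 4 * A ^ 2 * Real.log A
      - Real.pi ^ 2 / 3 * C + 1 / 6 * C ^ 3 + 3 / 2 * C ^ 2 - C ^ 2 * Real.log C
      + 2 * Real.pi ^ 2 / 3 * B + 2 / 3 * B ^ 3 - 6 * B ^ 2 + 4 * B ^ 2 * Real.log B
      + 4 * m ^ 2 * zetaSeries (m / (4 * Real.pi)) - 16 * A ^ 2 * zetaSeries (A / (2 * Real.pi))
      - 16 * B ^ 2 * zetaSeries (B / (2 * Real.pi))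
      + 4 * C ^ 2 * zetaSeries (C / (2 * Real.pi)) := by
  have h0 : 0 < z := by linarith
  -- The reciprocals of the four arguments all lie in `(1, 2)`, so their logarithms are in the range
  -- of `Li3_exp_neg`.
  have m1 : 1 < 1 / z := by rw [lt_div_iff₀ h0]; linarith
  have m2 : 1 / z < 2 := by rw [div_lt_iff₀ h0]; linarith
  have a1 : 1 < (1 + z) / (2 * z) := by rw [lt_div_iff₀ (by positivity)]; linarith
  have a2 : (1 + z) / (2 * z) < 2 := by rw [div_lt_iff₀ (by positivity)]; linarith
  have b1 : 1 < 2 / (1 + z) := by rw [lt_div_iff₀ (by positivity)]; linarith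
  have b2 : 2 / (1 + z) < 2 := by rw [div_lt_iff₀ (by positivity)]; linarith
  have c1 : 1 < (1 + z) ^ 2 / (4 * z) := by
    rw [lt_div_iff₀ (by positivity)]
    nlinarith [mul_pos (sub_pos.2 hz1) (sub_pos.2 hz1)]
  have c2 : (1 + z) ^ 2 / (4 * z) < 2 := by rw [div_lt_iff₀ (by positivity)]; nlinarith
  -- Because `w = z²`, the natural variable is `m/2`; hence `4π` and `log (m/2)` in the `m` terms
  -- only.
  have hm2 : m = 2 * Real.log (1 / z) := by
    rw [hm, ← hw, ← one_div_pow, Real.log_pow]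
    norm_num
  have em : m / (4 * Real.pi) = Real.log (1 / z) / (2 * Real.pi) := by
    rw [hm2]
    field_simp
    norm_num [mul_comm]
  have em' : 1 / 2 * m = Real.log (1 / z) := by rw [hm2]; ring
  refine ⟨em ▸ summable_zetaTerm_log m1 m2, hA ▸ summable_zetaTerm_log a1 a2,
    hB ▸ summable_zetaTerm_log b1 b2, hC ▸ summable_zetaTerm_log c1 c2, ?_⟩
  rw [← hw, Li3_sq h0 hz1, Li3_inv_of_mem_Ioo_one_two m1 m2 (by rw [one_div, inv_inv]),
    Li3_inv_of_mem_Ioo_one_two a1 a2 (inv_div _ _).symm,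
    Li3_inv_of_mem_Ioo_one_two b1 b2 (inv_div _ _).symm,
    Li3_inv_of_mem_Ioo_one_two c1 c2 (inv_div _ _).symm, em', em, hm2, ← hA, ← hB, ← hC]
  ring

theorem mainTheorem7 :
    (Summable (fun n : ℕ => zetaTerm (Real.log (3 / 2) / (4 * Real.pi)) (n + 1)) ∧
      Summable (fun n : ℕ => zetaTerm (Real.log ((√2 + √3) / (2 * √2)) / (2 * Real.pi)) (n + 1)) ∧
      Summable (fun n : ℕ => zetaTerm (Real.log (2 * √3 / (√2 + √3)) / (2 * Real.pi)) (n + 1)) ∧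
      Summable (fun n : ℕ => zetaTerm (Real.log ((5 + 2 * √6) / (4 * √6)) / (2 * Real.pi)) (n + 1)) ∧
      Li3 (2 / 3) =
        zetaNat 3 - 2 * Real.pi ^ 2 / 3 * Real.log (3 / 2) + 1 / 12 * Real.log (3 / 2) ^ 3
        + 3 / 2 * Real.log (3 / 2) ^ 2
        - Real.log (3 / 2) ^ 2 * Real.log (1 / 2 * Real.log (3 / 2))
        + 4 * Real.pi ^ 2 / 3 * Real.log ((√2 + √3) / (2 * √2))
        - 2 / 3 * Real.log ((√2 + √3) / (2 * √2)) ^ 3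
        - 6 * Real.log ((√2 + √3) / (2 * √2)) ^ 2
        + 4 * Real.log ((√2 + √3) / (2 * √2)) ^ 2 * Real.log (Real.log ((√2 + √3) / (2 * √2)))
        - Real.pi ^ 2 / 3 * Real.log ((5 + 2 * √6) / (4 * √6))
        + 1 / 6 * Real.log ((5 + 2 * √6) / (4 * √6)) ^ 3
        + 3 / 2 * Real.log ((5 + 2 * √6) / (4 * √6)) ^ 2
        - Real.log ((5 + 2 * √6) / (4 * √6)) ^ 2 * Real.log (Real.log ((5 + 2 * √6) / (4 * √6)))
        + 2 * Real.pi ^ 2 / 3 * Real.log (2 * √3 / (√2 + √3))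
        + 2 / 3 * Real.log (2 * √3 / (√2 + √3)) ^ 3
        - 6 * Real.log (2 * √3 / (√2 + √3)) ^ 2
        + 4 * Real.log (2 * √3 / (√2 + √3)) ^ 2 * Real.log (Real.log (2 * √3 / (√2 + √3)))
        + 4 * Real.log (3 / 2) ^ 2 * zetaSeries (Real.log (3 / 2) / (4 * Real.pi))
        - 16 * Real.log ((√2 + √3) / (2 * √2)) ^ 2 * zetaSeries (Real.log ((√2 + √3) / (2 * √2)) / (2 * Real.pi))
        - 16 * Real.log (2 * √3 / (√2 + √3)) ^ 2 * zetaSeries (Real.log (2 * √3 / (√2 + √3)) / (2 * Real.pi))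
        + 4 * Real.log ((5 + 2 * √6) / (4 * √6)) ^ 2 * zetaSeries (Real.log ((5 + 2 * √6) / (4 * √6)) / (2 * Real.pi)))
    ∧
    (Summable (fun n : ℕ => zetaTerm (Real.log (4 / 3) / (4 * Real.pi)) (n + 1)) ∧
      Summable (fun n : ℕ => zetaTerm (Real.log ((2 + √3) / (2 * √3)) / (2 * Real.pi)) (n + 1)) ∧
      Summable (fun n : ℕ => zetaTerm (Real.log (4 / (2 + √3)) / (2 * Real.pi)) (n + 1)) ∧
      Summable (fun n : ℕ => zetaTerm (Real.log ((7 + 4 * √3) / (8 * √3)) / (2 * Real.pi)) (n + 1)) ∧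
      Li3 (3 / 4) =
        zetaNat 3 - 2 * Real.pi ^ 2 / 3 * Real.log (4 / 3) + 1 / 12 * Real.log (4 / 3) ^ 3
        + 3 / 2 * Real.log (4 / 3) ^ 2
        - Real.log (4 / 3) ^ 2 * Real.log (1 / 2 * Real.log (4 / 3))
        + 4 * Real.pi ^ 2 / 3 * Real.log ((2 + √3) / (2 * √3))
        - 2 / 3 * Real.log ((2 + √3) / (2 * √3)) ^ 3
        - 6 * Real.log ((2 + √3) / (2 * √3)) ^ 2
        + 4 * Real.log ((2 + √3) / (2 * √3)) ^ 2 * Real.log (Real.log ((2 + √3) / (2 * √3)))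
        - Real.pi ^ 2 / 3 * Real.log ((7 + 4 * √3) / (8 * √3))
        + 1 / 6 * Real.log ((7 + 4 * √3) / (8 * √3)) ^ 3
        + 3 / 2 * Real.log ((7 + 4 * √3) / (8 * √3)) ^ 2
        - Real.log ((7 + 4 * √3) / (8 * √3)) ^ 2 * Real.log (Real.log ((7 + 4 * √3) / (8 * √3)))
        + 2 * Real.pi ^ 2 / 3 * Real.log (4 / (2 + √3))
        + 2 / 3 * Real.log (4 / (2 + √3)) ^ 3
        - 6 * Real.log (4 / (2 + √3)) ^ 2
        + 4 * Real.log (4 / (2 + √3)) ^ 2 * Real.log (Real.log (4 / (2 + √3)))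
        + 4 * Real.log (4 / 3) ^ 2 * zetaSeries (Real.log (4 / 3) / (4 * Real.pi))
        - 16 * Real.log ((2 + √3) / (2 * √3)) ^ 2 * zetaSeries (Real.log ((2 + √3) / (2 * √3)) / (2 * Real.pi))
        - 16 * Real.log (4 / (2 + √3)) ^ 2 * zetaSeries (Real.log (4 / (2 + √3)) / (2 * Real.pi))
        + 4 * Real.log ((7 + 4 * √3) / (8 * √3)) ^ 2 * zetaSeries (Real.log ((7 + 4 * √3) / (8 * √3)) / (2 * Real.pi))) := by
  have s2 : √(2 : ℝ) ^ 2 = 2 := Real.sq_sqrt (by norm_num)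
  have s3 : √(3 : ℝ) ^ 2 = 3 := Real.sq_sqrt (by norm_num)
  have s6 : √(6 : ℝ) = √2 * √3 := by rw [← Real.sqrt_mul (by norm_num)]; norm_num
  have p2 : 0 < √(2 : ℝ) := by positivity
  have p3 : 0 < √(3 : ℝ) := by positivity
  have h23 : √(2 : ℝ) < √3 := Real.sqrt_lt_sqrt (by norm_num) (by norm_num)
  constructor
  · have hz : (√2 / √3 : ℝ) ^ 2 = 2 / 3 := by rw [div_pow, s2, s3]
    refine Li3_sq_eq_zetaSeries (z := √2 / √3) ?_ ?_ hz ?_ ?_ ?_ ?_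
    · rw [div_lt_div_iff₀ (by norm_num) p3]
      nlinarith
    · rwa [div_lt_one p3]
    · norm_num
    · congr 1
      field_simp
      ring
    · congr 1
      field_simp
      ring
    · congr 1
      rw [s6]
      field_simp
      -- This is `(√2 + √3)² = 5 + 2√6`.
      linear_combination (-1) * s2 - s3
  · have hz : (√3 / 2 : ℝ) ^ 2 = 3 / 4 := by rw [div_pow, s3]; norm_num
    have h3 : √(3 : ℝ) < 2 := by nlinarith
    refine Li3_sq_eq_zetaSeries (z := √3 / 2) ?_ ?_ hz ?_ ?_ ?_ ?_
    · nlinarith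
    · linarith
    · norm_num
    · congr 1
      field_simp
    · congr 1
      field_simp
      ring
    · congr 1
      field_simp
      -- This is `(2 + √3)² = 7 + 4√3`.
      linear_combination (-8) * s3
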